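/- Let $\mathcal{A}$ be a finitely cocomplete homological category (that is, pointed, regular and protomodular, with finite colimits). For objects $X,Y$ let $\iota_{X,Y}\colon X\otimes Y\to X+Y$ denote the kernel of the comparison morphism $X+Y\to X\times Y$ (the co-smash product), which is functorial in $X$ and $Y$. Let $A$ and $G$ be objects of $\mathcal{A}$ and $\psi\colon A\otimes G\to A$ a morphism. Let $q\colon A+G\to A\rtimes_\psi G$ be the coequaliser of $\iota_{A,G}$ and $\iota_A\circ\psi$, where $\iota_A\colon A\to A+G$ and $\iota_G\colon G\to A+G$ are the coproduct inclusions; put $k_\psi=q\circ\iota_A$ and $s_\psi=q\circ\iota_G$, and let $p_\psi\colon A\rtimes_\psi G\to G$ be the morphism induced by the retraction $A+G\to G$ (zero on $A$, identity on $G$). One says that $\psi$ determines a $G$-action on $A$ if $k_\psi$ is a monomorphism; then $k_\psi$ is a kernel of $p_\psi$, and $p_\psi\circ s_\psi=1_G$. In that case $(A,\psi)$ is called a $G$-module (Beck module over $G$) if the object $p_\psi\colon A\rtimes_\psi G\to G$ of the slice category $(\mathcal{A}\downarrow G)$ carries an internal abelian group structure with unit $s_\psi$. For a normal monomorphism $n\colon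 N\to X$, the conjugation action $c^{N,X}\colon N\otimes X\to N$ is the unique morphism satisfying $n\circ c^{N,X}=\nabla_X\circ\iota_{X,X}\circ(n\otimes 1_X)$, where $\nabla_X\colon X+X\to X$ is the codiagonal. For $h\colon H\to G$, the pullback of $\psi$ along $h$ is $h^*(\psi)=\psi\circ(1_A\otimes h)\colon A\otimes H\to A$. **Theorem.** Let $A$ be an abelian object of $\mathcal{A}$ (an object carrying an internal Mal'tsev operation) endowed with a $G$-action determined by $\psi\colon A\otimes G\to A$. Then $(A,\psi)$ is a $G$-module if and only if the conjugation action of $A\rtimes_\psi G$ on its normal subobject $k_\psi\colon A\to A\rtimes_\psi G$ factors through the given $G$-action via $p_\psi$, that is, $$c^{A,A\rtimes_\psi G}=\psi\circ(1_A\otimes p_\psi)=p_\psi^*(\psi).$$ -/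

import Mathlib

open CategoryTheory CategoryTheory.Limits

universe v u

namespace HomologicalCategory

/-- A category with zero morphisms is protomodular if the Split Short Five Lemma holds in it:
given a morphism `(a, x, g)` between two split short exact sequences (a split epimorphism with a
chosen section, together with a kernel), if `a` and `g` are isomorphisms then so is `x`.
(Pointedness and the existence of finite limits are assumed separately.) -/
class Protomodular (C : Type u) [Category.{v} C] [HasZeroMorphisms C] : Prop where
  split_short_five : ∀ {A X G A' X' G' : C}
    {k' : A' ⟶ X'} {p' : X' ⟶ G'} {s' : G' ⟶ X'} {k : A ⟶ X} {p : X ⟶ G} {s : G ⟶ X}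
    (w' : k' ≫ p' = 0) (w : k ≫ p = 0),
    IsLimit (KernelFork.ofι k' w') → IsLimit (KernelFork.ofι k w) →
    s' ≫ p' = 𝟙 G' → s ≫ p = 𝟙 G →
    ∀ (a : A' ⟶ A) (x : X' ⟶ X) (g : G' ⟶ G),
      k' ≫ x = a ≫ k → x ≫ p = p' ≫ g → s' ≫ x = g ≫ s →
      IsIso a → IsIso g → IsIso x

/-- A homological category: pointed, regular and protomodular. -/
class Homological (C : Type u) [Category.{v} C] [HasZeroMorphisms C] : Prop
    extends HasZeroObject C, Regular C, Protomodular C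

noncomputable section

variable {C : Type u} [Category.{v} C]

/-- An object is abelian if it carries an internal Mal'tsev operation: a morphism
`g : A × A × A ⟶ A` with `g (x, x, z) = z` and `g (x, z, z) = x` on generalized elements. -/
def IsAbelianObject [HasFiniteProducts C] (A : C) : Prop :=
  ∃ g : A ⨯ (A ⨯ A) ⟶ A, ∀ (T : C) (x z : T ⟶ A),
    prod.lift x (prod.lift x z) ≫ g = z ∧ prod.lift x (prod.lift z z) ≫ g = x

section CoSmash

variable [HasZeroMorphisms C] [HasFiniteLimits C] [HasFiniteColimits C]

/-- The comparison morphism `⟨ρ_X, ρ_Y⟩ : X + Y ⟶ X × Y`. -/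
def comparison (X Y : C) : X ⨿ Y ⟶ X ⨯ Y :=
  prod.lift (coprod.desc (𝟙 X) 0) (coprod.desc 0 (𝟙 Y))

/-- The binary co-smash product (tensor product) `X ⊗ Y`: the kernel of `X + Y ⟶ X × Y`. -/
def coSmash (X Y : C) : C := kernel (comparison X Y)

/-- The kernel inclusion `ι_{X,Y} : X ⊗ Y ⟶ X + Y`. -/
def coSmashι (X Y : C) : coSmash X Y ⟶ X ⨿ Y := kernel.ι (comparison X Y)

lemma coSmashι_comparison (X Y : C) : coSmashι X Y ≫ comparison X Y = 0 :=
  kernel.condition _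

instance (X Y : C) : Mono (coSmashι X Y) :=
  inferInstanceAs (Mono (equalizer.ι (comparison X Y) 0))

/-- The universal property of `X ⊗ Y` as the kernel of `X + Y ⟶ X × Y`. -/
def coSmashLift {X Y T : C} (t : T ⟶ X ⨿ Y) (ht : t ≫ comparison X Y = 0) : T ⟶ coSmash X Y :=
  kernel.lift _ t ht

lemma coSmashLift_ι {X Y T : C} (t : T ⟶ X ⨿ Y) (ht : t ≫ comparison X Y = 0) :
    coSmashLift t ht ≫ coSmashι X Y = t :=
  kernel.lift_ι _ _ _

lemma coSmashι_fst (X Y : C) : coSmashι X Y ≫ coprod.desc (𝟙 X) 0 = 0 := by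
  have h := coSmashι_comparison X Y =≫ prod.fst
  rw [comparison, Category.assoc, prod.lift_fst, zero_comp] at h
  exact h

lemma coSmashι_snd (X Y : C) : coSmashι X Y ≫ coprod.desc 0 (𝟙 Y) = 0 := by
  have h := coSmashι_comparison X Y =≫ prod.snd
  rw [comparison, Category.assoc, prod.lift_snd, zero_comp] at h
  exact h

lemma coSmashMap_aux {X Y X' Y' : C} (f : X ⟶ X') (g : Y ⟶ Y') :
    (coSmashι X Y ≫ coprod.map f g) ≫ comparison X' Y' = 0 := by
  have h : coprod.map f g ≫ comparison X' Y' = comparison X Y ≫ prod.map f g := by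
    ext <;> simp [comparison]
  rw [Category.assoc, h, ← Category.assoc, coSmashι_comparison, zero_comp]

/-- Functoriality `f ⊗ g : X ⊗ Y ⟶ X' ⊗ Y'`, the restriction of `f + g`. -/
def coSmashMap {X Y X' Y' : C} (f : X ⟶ X') (g : Y ⟶ Y') : coSmash X Y ⟶ coSmash X' Y' :=
  coSmashLift (coSmashι X Y ≫ coprod.map f g) (coSmashMap_aux f g)

lemma coSmashMap_ι {X Y X' Y' : C} (f : X ⟶ X') (g : Y ⟶ Y') :
    coSmashMap f g ≫ coSmashι X' Y' = coSmashι X Y ≫ coprod.map f g :=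
  coSmashLift_ι _ _

/-- The conjugation action `c^{X,X} = c₂^X = ∇_X ∘ ι_{X,X} : X ⊗ X ⟶ X` of `X` on itself. -/
def selfConjugation (X : C) : coSmash X X ⟶ X :=
  coSmashι X X ≫ coprod.desc (𝟙 X) (𝟙 X)

lemma conjugation_aux {N X : C} (n : N ⟶ X) (hn : NormalMono n) :
    (coSmashMap n (𝟙 X) ≫ selfConjugation X) ≫ hn.g = 0 := by
  have h : coprod.map n (𝟙 X) ≫ coprod.desc (𝟙 X) (𝟙 X) ≫ hn.g
      = coprod.desc 0 (𝟙 X) ≫ hn.g := by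
    ext <;> simp [hn.w]
  rw [selfConjugation, ← Category.assoc (coSmashMap n (𝟙 X)), coSmashMap_ι, Category.assoc,
    Category.assoc, h, ← Category.assoc, coSmashι_snd, zero_comp]

/-- The conjugation action `c^{N,X} : N ⊗ X ⟶ N` of `X` on a normal subobject `n : N ⟶ X`:
the unique morphism with `n ∘ c^{N,X} = c^{X,X} ∘ (n ⊗ 1_X)`, see `conjugation_comp`. -/
def conjugation {N X : C} (n : N ⟶ X) (hn : NormalMono n) : coSmash N X ⟶ N :=
  hn.isLimit.lift (KernelFork.ofι (coSmashMap n (𝟙 X) ≫ selfConjugation X) (conjugation_aux n hn))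

lemma conjugation_comp {N X : C} (n : N ⟶ X) (hn : NormalMono n) :
    conjugation n hn ≫ n = coSmashMap n (𝟙 X) ≫ selfConjugation X :=
  hn.isLimit.fac _ WalkingParallelPair.zero

/-- The pullback `h^*(ψ) = ψ ∘ (1_A ⊗ h)` of `ψ : A ⊗ G ⟶ A` along `h : H ⟶ G`. -/
def pullbackAction {A G H : C} (h : H ⟶ G) (ψ : coSmash A G ⟶ A) : coSmash A H ⟶ A :=
  coSmashMap (𝟙 A) h ≫ ψ

section SemidirectProduct

variable {A G : C} (ψ : coSmash A G ⟶ A)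

/-- The semi-direct product `A ⋊_ψ G`: the coequalizer of `ι_{A,G}` and `ι_A ∘ ψ`.
(It is called so when `ψ` determines an action, see `DeterminesAction`.) -/
def semidirect : C := coequalizer (coSmashι A G) (ψ ≫ coprod.inl)

/-- The quotient morphism `q : A + G ⟶ A ⋊_ψ G`. -/
def semidirectπ : A ⨿ G ⟶ semidirect ψ := coequalizer.π (coSmashι A G) (ψ ≫ coprod.inl)

instance : IsRegularEpi (semidirectπ ψ) :=
  ⟨⟨coequalizerRegular (coSmashι A G) (ψ ≫ coprod.inl)⟩⟩

lemma semidirectπ_condition :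
    coSmashι A G ≫ semidirectπ ψ = (ψ ≫ coprod.inl) ≫ semidirectπ ψ :=
  coequalizer.condition _ _

/-- `k_ψ = q ∘ ι_A : A ⟶ A ⋊_ψ G`. -/
def semidirectInl : A ⟶ semidirect ψ := coprod.inl ≫ semidirectπ ψ

/-- `s_ψ = q ∘ ι_G : G ⟶ A ⋊_ψ G`. -/
def semidirectInr : G ⟶ semidirect ψ := coprod.inr ≫ semidirectπ ψ

/-- `p_ψ : A ⋊_ψ G ⟶ G`, induced by the retraction `ρ_G : A + G ⟶ G`. -/
def semidirectProj : semidirect ψ ⟶ G :=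
  coequalizer.desc (coprod.desc 0 (𝟙 G)) (by
    rw [coSmashι_snd, Category.assoc, coprod.inl_desc, comp_zero])

lemma semidirectπ_proj : semidirectπ ψ ≫ semidirectProj ψ = coprod.desc 0 (𝟙 G) :=
  coequalizer.π_desc _ _

lemma semidirectInl_proj : semidirectInl ψ ≫ semidirectProj ψ = 0 := by
  rw [semidirectInl, Category.assoc, semidirectπ_proj, coprod.inl_desc]

lemma semidirectInr_proj : semidirectInr ψ ≫ semidirectProj ψ = 𝟙 G := by
  rw [semidirectInr, Category.assoc, semidirectπ_proj, coprod.inr_desc]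

/-- `ψ : A ⊗ G ⟶ A` determines (or induces) a `G`-action on `A` if `k_ψ` is a monomorphism. -/
def DeterminesAction : Prop := Mono (semidirectInl ψ)

end SemidirectProduct

end CoSmash

section BeckModule

open MonoidalCategory

attribute [local instance] Over.cartesianMonoidalCategory Over.braidedCategory

/-- A point `(p : X ⟶ G, s : G ⟶ X)` carries a Beck module structure if there is an internal
abelian group structure on the object `p` of the slice category over `G` whose unit, as a morphism
from the terminal object `𝟙 G` to `p`, is `s`. -/
def IsBeckModule [HasPullbacks C] {X G : C} (p : X ⟶ G) (s : G ⟶ X) : Prop :=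
  ∃ M : CommGrpObj (Over.mk p), (M.one : 𝟙_ (Over G) ⟶ Over.mk p).left = s

end BeckModule

section Homological

variable [HasZeroMorphisms C] [HasFiniteColimits C] [Homological C]

/-- `(A, ψ)` is a `G`-module: the point `(p_ψ, s_ψ)` over `G` corresponding to the action
determined by `ψ` carries a Beck module structure. -/
def IsGModule {A G : C} (ψ : coSmash A G ⟶ A) : Prop :=
  IsBeckModule (semidirectProj ψ) (semidirectInr ψ)

/-- In a split short exact sequence the kernel and the section are jointly extremally epic. -/
lemma isIso_of_factors {A X G M : C} {k : A ⟶ X} {p : X ⟶ G} {s : G ⟶ X} (w : k ≫ p = 0)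
    (hk : IsLimit (KernelFork.ofι k w)) (hs : s ≫ p = 𝟙 G) (m : M ⟶ X) [Mono m]
    (k' : A ⟶ M) (s' : G ⟶ M) (hk' : k' ≫ m = k) (hs' : s' ≫ m = s) : IsIso m := by
  have w' : k' ≫ (m ≫ p) = 0 := by rw [← Category.assoc, hk', w]
  have : Mono k' := by
    have : Mono (k' ≫ m) := by rw [hk']; exact mono_of_isLimit_fork hk
    exact mono_of_mono k' m
  have hl : IsLimit (KernelFork.ofι k' w') := by
    refine KernelFork.IsLimit.ofι' k' w' (fun {T} t ht => ?_)
    have ht' : (t ≫ m) ≫ p = 0 := by rw [Category.assoc, ht]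
    refine ⟨hk.lift (KernelFork.ofι (t ≫ m) ht'), ?_⟩
    rw [← cancel_mono m, Category.assoc, hk']
    exact hk.fac (KernelFork.ofι (t ≫ m) ht') WalkingParallelPair.zero
  exact Protomodular.split_short_five w' w hl hk (by rw [← Category.assoc, hs', hs]) hs
    (𝟙 A) m (𝟙 G) (by simp [hk']) (by simp) (by simp [hs']) inferInstance inferInstance

/-- If `ψ` determines an action, then `k_ψ` is the kernel of `p_ψ`. -/
lemma semidirectInl_isKernel {A G : C} (ψ : coSmash A G ⟶ A) (hψ : DeterminesAction ψ) :
    Nonempty (IsLimit (KernelFork.ofι (semidirectInl ψ) (semidirectInl_proj ψ))) := by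
  have : Mono (semidirectInl ψ) := hψ
  let ρ : A ⨿ G ⟶ G := coprod.desc 0 (𝟙 G)
  let κ : kernel ρ ⟶ A ⨿ G := kernel.ι ρ
  let j : kernel (semidirectProj ψ) ⟶ semidirect ψ := kernel.ι (semidirectProj ψ)
  have hκ : κ ≫ ρ = 0 := kernel.condition ρ
  have hj : j ≫ semidirectProj ψ = 0 := kernel.condition _
  have hq : semidirectπ ψ ≫ semidirectProj ψ = ρ := semidirectπ_proj ψ
  let k' : A ⟶ kernel (semidirectProj ψ) := kernel.lift _ (semidirectInl ψ) (semidirectInl_proj ψ)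
  have hk' : k' ≫ j = semidirectInl ψ := kernel.lift_ι _ _ _
  let t : kernel ρ ⟶ kernel (semidirectProj ψ) :=
    kernel.lift _ (κ ≫ semidirectπ ψ) (by rw [Category.assoc, hq, hκ])
  have ht : t ≫ j = κ ≫ semidirectπ ψ := kernel.lift_ι _ _ _
  -- `t` is a pullback of the regular epimorphism `q`
  have hpb : IsPullback κ t (semidirectπ ψ) j := by
    refine ⟨⟨ht.symm⟩, ⟨PullbackCone.IsLimit.mk _
      (fun c => kernel.lift ρ c.fst (by rw [← hq, ← Category.assoc, c.condition,
        Category.assoc, hj, comp_zero])) (fun c => kernel.lift_ι _ _ _) (fun c => ?_)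
      (fun c m h1 _ => ?_)⟩⟩
    · rw [← cancel_mono j, Category.assoc, ht, ← Category.assoc, kernel.lift_ι, c.condition]
    · rw [← cancel_mono κ, h1]; exact (kernel.lift_ι _ _ _).symm
  have : IsRegularEpi t :=
    Regular.regularEpiIsStableUnderBaseChange.of_isPullback hpb
      (by dsimp [MorphismProperty.regularEpi]; infer_instance)
  -- the kernel of `ρ_G` is generated by `A ⊗ G` and `A`
  let a : A ⟶ kernel ρ := kernel.lift ρ coprod.inl (coprod.inl_desc _ _)
  let b : coSmash A G ⟶ kernel ρ := kernel.lift ρ (coSmashι A G) (coSmashι_snd A G)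
  have ha : a ≫ κ = coprod.inl := kernel.lift_ι _ _ _
  have hb : b ≫ κ = coSmashι A G := kernel.lift_ι _ _ _
  let π : kernel ρ ⟶ A := κ ≫ coprod.desc (𝟙 A) 0
  have haπ : a ≫ π = 𝟙 A := by rw [← Category.assoc, ha, coprod.inl_desc]
  have hbπ : b ≫ π = 0 := by rw [← Category.assoc, hb, coSmashι_fst]
  have : Mono b := by
    have : Mono (b ≫ κ) := by rw [hb]; infer_instance
    exact mono_of_mono b κ
  have hbker : IsLimit (KernelFork.ofι b hbπ) := by
    refine KernelFork.IsLimit.ofι' b hbπ (fun {T} z hz => ?_)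
    have hz' : (z ≫ κ) ≫ comparison A G = 0 := by
      apply Limits.prod.hom_ext
      · rw [comparison, Category.assoc, prod.lift_fst, zero_comp, Category.assoc]; exact hz
      · rw [comparison, Category.assoc, prod.lift_snd, zero_comp, Category.assoc]
        exact (congrArg (z ≫ ·) hκ).trans comp_zero
    refine ⟨coSmashLift (z ≫ κ) hz', ?_⟩
    rw [← cancel_mono κ, Category.assoc, hb, coSmashLift_ι]
  have hat : a ≫ t = 𝟙 A ≫ k' := by
    rw [← cancel_mono j, Category.assoc, ht, ← Category.assoc, ha, Category.assoc, hk',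
      Category.id_comp]; rfl
  have hbt : b ≫ t = ψ ≫ k' := by
    rw [← cancel_mono j, Category.assoc, ht, ← Category.assoc, hb, Category.assoc, hk',
      semidirectπ_condition, Category.assoc]; rfl
  have : Mono k' := by
    have : Mono (k' ≫ j) := by rw [hk']; infer_instance
    exact mono_of_mono k' j
  have : IsIso (pullback.fst t k') :=
    isIso_of_factors hbπ hbker haπ (pullback.fst t k')
      (pullback.lift b ψ hbt) (pullback.lift a (𝟙 A) hat)
      (pullback.lift_fst _ _ _) (pullback.lift_fst _ _ _)
  have hfac : (inv (pullback.fst t k') ≫ pullback.snd t k') ≫ k' = t := by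
    rw [Category.assoc, ← pullback.condition, IsIso.inv_hom_id_assoc]
  have : StrongEpi k' := by
    have : StrongEpi ((inv (pullback.fst t k') ≫ pullback.snd t k') ≫ k') := by
      rw [hfac]; infer_instance
    exact strongEpi_of_strongEpi (inv (pullback.fst t k') ≫ pullback.snd t k') k'
  have : IsIso k' := isIso_of_mono_of_strongEpi k'
  exact ⟨IsLimit.ofIsoLimit (kernelIsKernel (semidirectProj ψ))
    (Fork.ext (asIso k') (by exact hk')).symm⟩

/-- If `ψ` determines an action, then `k_ψ : A ⟶ A ⋊_ψ G` is a normal monomorphism. -/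
@[reducible] def semidirectInlNormalMono {A G : C} (ψ : coSmash A G ⟶ A)
    (hψ : DeterminesAction ψ) : NormalMono (semidirectInl ψ) where
  Z := G
  g := semidirectProj ψ
  w := semidirectInl_proj ψ
  isLimit := (semidirectInl_isKernel ψ hψ).some

end Homological

end

end HomologicalCategory

open HomologicalCategory

/-! Write `X` for the semidirect product, with `k`, `p`, `s` its kernel, projection and section.
Since `[k, s p]` is `q` after `1 + p`, the morphism `p^*(ψ)` is the action of `X` on `A` through `s
p`. As `k` is monic, the criterion therefore says that `[k, 1]` and `[k, s p]` agree on `A ⊗ X`.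

A module structure is an addition `m` on the fibre square of `p`. Its first projection is a split
extension of `X` by `A`, with kernel `(0, k)` and section `(1, s p)`, and the corresponding action
is again `p^*(ψ)`. By the universal property of semidirect products (`exists_desc_of_action`), a
morphism `m` restricting to `k` on the kernel and to `1` on the section exists once `[k, 1]`
satisfies the criterion.

Protomodularity makes such an `m` an abelian group structure (`exists_commGrpObj_of_unital`): kernel
and section are jointly epic, so the identities need checking only on them, and inverses come from
the Split Short Five Lemma. Conversely, the unit laws of a given addition force the criterion
(`conjugation_of_isBeckModule`). -/

namespace HomologicalCategory

open MonoidalCategory CartesianMonoidalCategory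

attribute [local instance] Over.cartesianMonoidalCategory Over.braidedCategory

variable {C : Type u} [Category.{v} C] [HasZeroMorphisms C] [HasFiniteColimits C] [Homological C]

/-- The kernel and the section of a split short exact sequence are jointly epic. -/
lemma hom_ext_of_split {A X G Z : C} {k : A ⟶ X} {p : X ⟶ G} {s : G ⟶ X} (w : k ≫ p = 0)
    (hk : IsLimit (KernelFork.ofι k w)) (hs : s ≫ p = 𝟙 G) {f g : X ⟶ Z}
    (hkf : k ≫ f = k ≫ g) (hsf : s ≫ f = s ≫ g) : f = g := by
  have : IsIso (equalizer.ι f g) :=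
    isIso_of_factors w hk hs _ (equalizer.lift k hkf) (equalizer.lift s hsf)
      (equalizer.lift_ι _ _) (equalizer.lift_ι _ _)
  rw [← cancel_epi (equalizer.ι f g), equalizer.condition]

/-! ### Points over `G` and their fibre products -/

section Over

variable {A G : C} {Q Y Z : Over G}

omit [HasFiniteColimits C] in
lemma toUnit_comp_left (η : 𝟙_ (Over G) ⟶ Y) :
    (toUnit (Over.mk (0 : A ⟶ G)) ≫ η).left = 0 := by
  simp

lemma over_hom_ext (κ : Over.mk (0 : A ⟶ G) ⟶ Q) (w : κ.left ≫ Q.hom = 0)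
    (hκ : IsLimit (KernelFork.ofι κ.left w)) (η : 𝟙_ (Over G) ⟶ Q) {f g : Q ⟶ Z}
    (h₁ : κ ≫ f = κ ≫ g) (h₂ : η ≫ f = η ≫ g) : f = g := by
  ext
  exact hom_ext_of_split w hκ (Over.w η) (congrArg (·.left) h₁) (congrArg (·.left) h₂)

lemma lift_unit_left_fst (κ : Over.mk (0 : A ⟶ G) ⟶ Q) (ηY : 𝟙_ (Over G) ⟶ Y) :
    (lift (toUnit _ ≫ ηY) κ).left ≫ (fst Y Q).left = 0 := by
  rw [← Over.comp_left, lift_fst, toUnit_comp_left]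

/-- If `κ` is the kernel of `Q`, then `(0, κ)` is the kernel of the projection `Y × Q ⟶ Y`. -/
noncomputable def isKernelFst (κ : Over.mk (0 : A ⟶ G) ⟶ Q) (w : κ.left ≫ Q.hom = 0)
    (hκ : IsLimit (KernelFork.ofι κ.left w)) (ηY : 𝟙_ (Over G) ⟶ Y) :
    IsLimit (KernelFork.ofι (lift (toUnit _ ≫ ηY) κ).left (lift_unit_left_fst κ ηY)) := by
  have : Mono κ.left := mono_of_isLimit_fork hκ
  have : Mono (lift (toUnit _ ≫ ηY) κ).left := by
    have : Mono ((lift (toUnit _ ≫ ηY) κ).left ≫ (snd Y Q).left) := by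
      rw [← Over.comp_left, lift_snd]; infer_instance
    exact mono_of_mono _ (snd Y Q).left
  refine KernelFork.IsLimit.ofι' _ _ fun {T} t ht => ?_
  have hs : (t ≫ (snd Y Q).left) ≫ Q.hom = 0 := by
    rw [Category.assoc, Over.w, ← Over.w (fst Y Q), reassoc_of% ht, zero_comp]
  refine ⟨hκ.lift (KernelFork.ofι (t ≫ (snd Y Q).left) hs), ?_⟩
  have hl : hκ.lift (KernelFork.ofι (t ≫ (snd Y Q).left) hs) ≫ κ.left = t ≫ (snd Y Q).left :=
    hκ.fac _ WalkingParallelPair.zero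
  refine Over.tensorObj_ext _ _ ?_ ?_
  · refine Eq.trans ?_ ht.symm
    refine (Category.assoc _ _ _).trans ?_
    exact (congrArg _ (lift_unit_left_fst κ ηY)).trans comp_zero
  · refine Eq.trans ?_ hl
    refine (Category.assoc _ _ _).trans (congrArg _ ?_)
    exact congrArg (·.left) (lift_snd (toUnit _ ≫ ηY) κ)

/-- The first projection is split by `(1, 0)` with kernel `(0, κ)`, and these two are jointly epic.
Identities for a multiplication are tested this way, one variable at a time. -/
lemma tensor_hom_ext (κ : Over.mk (0 : A ⟶ G) ⟶ Q) (w : κ.left ≫ Q.hom = 0)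
    (hκ : IsLimit (KernelFork.ofι κ.left w)) (η : 𝟙_ (Over G) ⟶ Q) (ηY : 𝟙_ (Over G) ⟶ Y)
    {f g : Y ⊗ Q ⟶ Z} (h₁ : lift (toUnit _ ≫ ηY) κ ≫ f = lift (toUnit _ ≫ ηY) κ ≫ g)
    (h₂ : lift (𝟙 Y) (toUnit Y ≫ η) ≫ f = lift (𝟙 Y) (toUnit Y ≫ η) ≫ g) : f = g := by
  ext
  refine hom_ext_of_split (lift_unit_left_fst κ ηY) (isKernelFst κ w hκ ηY)
    (s := (lift (𝟙 Y) (toUnit Y ≫ η)).left) ?_ (congrArg (·.left) h₁) (congrArg (·.left) h₂)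
  rw [← Over.comp_left, lift_fst, Over.id_left]

/-! ### From a unital multiplication to an abelian group -/

section Multiplication

variable (κ : Over.mk (0 : A ⟶ G) ⟶ Q) (w : κ.left ≫ Q.hom = 0)
  (hκ : IsLimit (KernelFork.ofι κ.left w)) (η : 𝟙_ (Over G) ⟶ Q) (m : Q ⊗ Q ⟶ Q)
  (hm₁ : lift (toUnit _ ≫ η) κ ≫ m = κ) (hm₂ : lift (𝟙 Q) (toUnit Q ≫ η) ≫ m = 𝟙 Q)

omit [HasFiniteColimits C] in
include hm₂ in
lemma lift_unit_comp_mul {T : Over G} (x : T ⟶ Q) : lift x (toUnit _ ≫ η) ≫ m = x := by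
  rw [show lift x (toUnit _ ≫ η) = x ≫ lift (𝟙 Q) (toUnit Q ≫ η) by simp, Category.assoc, hm₂,
    Category.comp_id]

include hκ hm₁ hm₂ in
-- The left unit law is assumed only on the kernel `κ`; on `η` it follows from the right unit law,
-- and `κ`, `η` are jointly epic.
lemma unit_lift_comp_mul {T : Over G} (x : T ⟶ Q) : lift (toUnit _ ≫ η) x ≫ m = x := by
  have h : lift (toUnit Q ≫ η) (𝟙 Q) ≫ m = 𝟙 Q := by
    refine over_hom_ext κ w hκ η ?_ ?_
    · rw [comp_lift_assoc, ← Category.assoc, Category.comp_id, toUnit_unique (κ ≫ toUnit Q)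
        (toUnit _), hm₁]
    · have := lift_unit_comp_mul η m hm₂ η
      rw [comp_lift_assoc, ← Category.assoc, Category.comp_id]
      rw [toUnit_unique (toUnit (𝟙_ (Over G))) (𝟙 _), Category.id_comp] at this
      rw [toUnit_unique (η ≫ toUnit Q) (𝟙 _), Category.id_comp, this]
  rw [show lift (toUnit _ ≫ η) x = x ≫ lift (toUnit Q ≫ η) (𝟙 Q) by simp, Category.assoc, h,
    Category.comp_id]

include hκ hm₁ hm₂ in
lemma mul_comm_of_unital {T : Over G} (x y : T ⟶ Q) : lift x y ≫ m = lift y x ≫ m := by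
  have h : m = lift (snd Q Q) (fst Q Q) ≫ m := by
    refine tensor_hom_ext κ w hκ η η ?_ ?_
    · rw [comp_lift_assoc, lift_snd, lift_fst, hm₁, lift_unit_comp_mul η m hm₂]
    · rw [comp_lift_assoc, lift_snd, lift_fst, hm₂, unit_lift_comp_mul κ w hκ η m hm₁ hm₂]
  conv_lhs => rw [h]
  rw [comp_lift_assoc, lift_snd, lift_fst]

include hκ hm₁ hm₂ in
lemma mul_assoc_of_unital :
    (m ▷ Q) ≫ m = (α_ Q Q Q).hom ≫ (Q ◁ m) ≫ m := by
  have hl : m ▷ Q = lift (fst _ _ ≫ m) (snd _ _) := by ext1 <;> simp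
  have hr : (α_ Q Q Q).hom ≫ Q ◁ m =
      lift (fst _ _ ≫ fst _ _) (lift (fst _ _ ≫ snd _ _) (snd _ _) ≫ m) := by
    ext1
    · simp
    · simp only [Category.assoc, whiskerLeft_snd, lift_snd]
      rw [← Category.assoc]
      congr 1
      ext1 <;> simp
  rw [← Category.assoc, hr, hl]
  -- With `Y = Q ⊗ Q`, it suffices to compare the triples `(0, 0, κ)` and `(x, y, 0)`, where the
  -- unit laws decide.
  refine tensor_hom_ext κ w hκ η (lift η η) ?_ ?_
  · simp only [comp_lift_assoc, comp_lift, lift_fst_assoc, lift_snd, lift_fst,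
      lift_unit_comp_mul η m hm₂, unit_lift_comp_mul κ w hκ η m hm₁ hm₂]
  · simp only [comp_lift_assoc, lift_fst_assoc, lift_snd, lift_unit_comp_mul η m hm₂,
      Category.id_comp, lift_fst_snd]

include hκ hm₁ hm₂ in
-- The shear `(x, y) ↦ (x, x + y)` fixes the kernel `(0, κ)` and the base, and carries the section
-- `(x, 0)` to the diagonal, so the Split Short Five Lemma applies.
lemma isIso_shear : IsIso (lift (fst Q Q) m) := by
  have : IsIso (lift (fst Q Q) m).left := by
    refine Protomodular.split_short_five (lift_unit_left_fst κ η) (lift_unit_left_fst κ η)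
      (isKernelFst κ w hκ η) (isKernelFst κ w hκ η)
      (s' := (lift (𝟙 Q) (toUnit Q ≫ η)).left) (s := (lift (𝟙 Q) (𝟙 Q)).left)
      ?_ ?_ (𝟙 _) _ (𝟙 _) ?_ ?_ ?_ inferInstance inferInstance
    · rw [← Over.comp_left, lift_fst, Over.id_left]
    · rw [← Over.comp_left, lift_fst, Over.id_left]
    · rw [← Over.comp_left, comp_lift, lift_fst, hm₁, Category.id_comp]
    · rw [← Over.comp_left, lift_fst, Category.comp_id]
    · rw [← Over.comp_left, comp_lift, lift_fst, hm₂, Category.id_comp]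
  have : IsIso ((Over.forget G).map (lift (fst Q Q) m)) := this
  exact isIso_of_reflects_iso _ (Over.forget G)

include hκ hm₁ hm₂ in
/-- In a protomodular category, a unital multiplication on a point is an internal abelian group
structure. -/
lemma exists_commGrpObj_of_unital : ∃ M : CommGrpObj Q, M.one = η := by
  have := isIso_shear κ w hκ η m hm₁ hm₂
  -- The difference `d (x, y) = y - x`; negation is then `d (x, 0)`.
  let d : Q ⊗ Q ⟶ Q := inv (lift (fst Q Q) m) ≫ snd Q Q
  have hd : lift (fst Q Q) d ≫ m = snd Q Q := by
    have h : lift (fst Q Q) d = inv (lift (fst Q Q) m) := by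
      ext1
      · rw [lift_fst, IsIso.eq_inv_comp, lift_fst]
      · rw [lift_snd]
    rw [h, IsIso.inv_comp_eq, lift_snd]
  let i : Q ⟶ Q := lift (𝟙 Q) (toUnit Q ≫ η) ≫ d
  have hi : lift (𝟙 Q) i ≫ m = toUnit Q ≫ η := by
    have h := congrArg (lift (𝟙 Q) (toUnit Q ≫ η) ≫ ·) hd
    simpa only [comp_lift_assoc, lift_fst, lift_snd] using h
  let M : MonObj Q :=
    { one := η
      mul := m
      one_mul := by
        have h : η ▷ Q = lift (toUnit _ ≫ η) (snd _ _) := by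
          ext1
          · rw [whiskerRight_fst, lift_fst, toUnit_unique (fst _ _) (toUnit _)]
          · rw [whiskerRight_snd, lift_snd]
        rw [h, unit_lift_comp_mul κ w hκ η m hm₁ hm₂, leftUnitor_hom]
      mul_one := by
        have h : Q ◁ η = lift (fst _ _) (toUnit _ ≫ η) := by
          ext1
          · rw [whiskerLeft_fst, lift_fst]
          · rw [whiskerLeft_snd, lift_snd, toUnit_unique (snd _ _) (toUnit _)]
        rw [h, lift_unit_comp_mul η m hm₂, rightUnitor_hom]
      mul_assoc := mul_assoc_of_unital κ w hκ η m hm₁ hm₂ }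
  let Gr : GrpObj Q :=
    { M with
      inv := i
      left_inv := (mul_comm_of_unital κ w hκ η m hm₁ hm₂ _ _).trans hi
      right_inv := hi }
  refine ⟨{ Gr with mul_comm := ?_ }, rfl⟩
  have h : (β_ Q Q).hom = lift (snd Q Q) (fst Q Q) := by ext1 <;> simp
  change (β_ Q Q).hom ≫ m = m
  rw [h, mul_comm_of_unital κ w hκ η m hm₁ hm₂, lift_fst_snd, Category.id_comp]

end Multiplication

end Over

/-! ### Conjugation and Beck modules -/

section BeckModuleCriterion

variable {A G : C}

lemma conjugation_eq_iff {X : C} {k : A ⟶ X} (hk : NormalMono k) (φ : coSmash A X ⟶ A) :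
    conjugation k hk = φ ↔ coSmashι A X ≫ coprod.desc k (𝟙 X) = φ ≫ k := by
  have : Mono k := mono_of_isLimit_fork hk.isLimit
  rw [← cancel_mono k, conjugation_comp, selfConjugation, ← Category.assoc, coSmashMap_ι,
    Category.assoc, coprod.map_desc]
  simp

/-- A morphism out of a split extension is determined by compatible morphisms out of the kernel
and out of the section. -/
lemma exists_desc_of_action {X Y Z : C} {k : A ⟶ X} {p : X ⟶ Y} {s : Y ⟶ X} (w : k ≫ p = 0)
    (hk : IsLimit (KernelFork.ofι k w)) (hs : s ≫ p = 𝟙 Y) (φ : coSmash A Y ⟶ A)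
    (hφ : coSmashι A Y ≫ coprod.desc k s = φ ≫ k) (a : A ⟶ Z) (b : Y ⟶ Z)
    (hab : coSmashι A Y ≫ coprod.desc a b = φ ≫ a) : ∃ f : X ⟶ Z, k ≫ f = a ∧ s ≫ f = b := by
  let e : semidirect φ ⟶ X :=
    coequalizer.desc (coprod.desc k s) (by rw [hφ, Category.assoc, coprod.inl_desc])
  have he : semidirectπ φ ≫ e = coprod.desc k s := coequalizer.π_desc _ _
  have hke : semidirectInl φ ≫ e = k := by
    rw [semidirectInl, Category.assoc, he, coprod.inl_desc]
  have hse : semidirectInr φ ≫ e = s := by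
    rw [semidirectInr, Category.assoc, he, coprod.inr_desc]
  -- Monicity of `k` passes to `semidirectInl φ`, so the semidirect product is a split extension and
  -- `e` is an isomorphism.
  have hact : DeterminesAction φ := by
    have : Mono (semidirectInl φ ≫ e) := by rw [hke]; exact mono_of_isLimit_fork hk
    exact mono_of_mono (semidirectInl φ) e
  obtain ⟨hl⟩ := semidirectInl_isKernel φ hact
  have hep : e ≫ p = semidirectProj φ ≫ 𝟙 Y := by
    refine hom_ext_of_split (semidirectInl_proj φ) hl (semidirectInr_proj φ) ?_ ?_
    · rw [reassoc_of% hke, w, Category.comp_id, semidirectInl_proj]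
    · rw [reassoc_of% hse, hs, Category.comp_id, semidirectInr_proj]
  have : IsIso e := Protomodular.split_short_five _ w hl hk (semidirectInr_proj φ) hs
    (𝟙 A) e (𝟙 Y) (by rw [hke, Category.id_comp]) hep (by rw [hse, Category.id_comp])
    inferInstance inferInstance
  let f : semidirect φ ⟶ Z :=
    coequalizer.desc (coprod.desc a b) (by rw [hab, Category.assoc, coprod.inl_desc])
  have hf : semidirectπ φ ≫ f = coprod.desc a b := coequalizer.π_desc _ _
  refine ⟨inv e ≫ f, ?_, ?_⟩
  · rw [← hke, Category.assoc, IsIso.hom_inv_id_assoc, semidirectInl, Category.assoc, hf,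
      coprod.inl_desc]
  · rw [← hse, Category.assoc, IsIso.hom_inv_id_assoc, semidirectInr, Category.assoc, hf,
      coprod.inr_desc]

/-- If a point over `G` is a Beck module then conjugation by its total object on its kernel
coincides with the action through the projection and the section. -/
lemma conjugation_of_isBeckModule {X : C} {k : A ⟶ X} {p : X ⟶ G} {s : G ⟶ X} (w : k ≫ p = 0)
    (h : IsBeckModule p s) :
    coSmashι A X ≫ coprod.desc k (𝟙 X) = coSmashι A X ≫ coprod.desc k (p ≫ s) := by
  obtain ⟨M, hM⟩ := h
  let Q := Over.mk p
  let η : 𝟙_ (Over G) ⟶ Q := M.one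
  let m : Q ⊗ Q ⟶ Q := M.mul
  have hone {T : Over G} (x : T ⟶ Q) : lift (toUnit _ ≫ η) x ≫ m = x :=
    MonObj.lift_comp_one_left _ _
  have hone' {T : Over G} (x : T ⟶ Q) : lift x (toUnit _ ≫ η) ≫ m = x :=
    MonObj.lift_comp_one_right _ _
  let κ : Over.mk (0 : A ⟶ G) ⟶ Q := Over.homMk k w
  -- `e` is `(k, 0)` on `A` and `(s p, 1)` on `X`. Its second component kills `A ⊗ X`, so there the
  -- sum `[k, 1]` of the components equals the first one, `[k, s p]`.
  let e : A ⨿ X ⟶ (Q ⊗ Q).left :=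
    coprod.desc (lift κ (toUnit _ ≫ η)).left (lift (toUnit Q ≫ η) (𝟙 Q)).left
  have hη : (toUnit Q ≫ η).left = p ≫ s := by
    rw [← hM]; rfl
  have hem : e ≫ m.left = coprod.desc k (𝟙 X) := by
    ext
    · rw [coprod.inl_desc_assoc, ← Over.comp_left, hone', coprod.inl_desc]
      rfl
    · rw [coprod.inr_desc_assoc, ← Over.comp_left, hone, coprod.inr_desc]
      rfl
  have he₁ : e ≫ (fst Q Q).left = coprod.desc k (p ≫ s) := by
    ext
    · rw [coprod.inl_desc_assoc, ← Over.comp_left, lift_fst, coprod.inl_desc]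
      rfl
    · rw [coprod.inr_desc_assoc, ← Over.comp_left, lift_fst, coprod.inr_desc, hη]
  have he₂ : e ≫ (snd Q Q).left = coprod.desc 0 (𝟙 X) := by
    ext
    · rw [coprod.inl_desc_assoc, ← Over.comp_left, lift_snd, coprod.inl_desc, toUnit_comp_left]
    · rw [coprod.inr_desc_assoc, ← Over.comp_left, lift_snd, coprod.inr_desc]
      rfl
  have hker : (coSmashι A X ≫ coprod.desc k (p ≫ s)) ≫ p = 0 := by
    have hp : coprod.desc k (p ≫ s) ≫ p = coprod.desc 0 (𝟙 X) ≫ p := by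
      have hs : s ≫ p = 𝟙 G := by rw [← hM]; exact Over.w η
      ext <;> simp [w, hs]
    rw [Category.assoc, hp, reassoc_of% coSmashι_snd, zero_comp]
  let y : Over.mk (0 : coSmash A X ⟶ G) ⟶ Q :=
    Over.homMk (coSmashι A X ≫ coprod.desc k (p ≫ s)) hker
  have hy : coSmashι A X ≫ e = (lift y (toUnit _ ≫ η)).left := by
    refine Over.tensorObj_ext _ _ ?_ ?_
    · refine (Category.assoc _ _ _).trans ((congrArg _ he₁).trans ?_)
      exact (congrArg (·.left) (lift_fst y (toUnit _ ≫ η))).symm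
    · refine (Category.assoc _ _ _).trans ((congrArg _ he₂).trans ?_)
      refine (coSmashι_snd A X).trans ?_
      exact ((congrArg (·.left) (lift_snd y (toUnit _ ≫ η))).trans (toUnit_comp_left η)).symm
  rw [← hem, ← Category.assoc, hy, ← Over.comp_left, hone']
  rfl

/-- If conjugation by the total object of a split extension on its kernel is the action `φ` through
the projection and the section, then the split extension is a Beck module. -/
lemma isBeckModule_of_conjugation {X : C} {k : A ⟶ X} {p : X ⟶ G} {s : G ⟶ X} (w : k ≫ p = 0)
    (hk : IsLimit (KernelFork.ofι k w)) (hs : s ≫ p = 𝟙 G) (φ : coSmash A X ⟶ A)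
    (hφ : coSmashι A X ≫ coprod.desc k (p ≫ s) = φ ≫ k)
    (h : coSmashι A X ≫ coprod.desc k (𝟙 X) = φ ≫ k) : IsBeckModule p s := by
  let Q := Over.mk p
  let η : 𝟙_ (Over G) ⟶ Q := Over.homMk s hs
  let κ : Over.mk (0 : A ⟶ G) ⟶ Q := Over.homMk k w
  let κ' := lift (toUnit _ ≫ η) κ
  let σ' := lift (𝟙 Q) (toUnit Q ≫ η)
  have w' : κ'.left ≫ (fst Q Q).left = 0 := lift_unit_left_fst κ η
  have hσ' : σ'.left ≫ (fst Q Q).left = 𝟙 X := by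
    rw [← Over.comp_left, lift_fst]
    rfl
  -- The first projection of the fibre square carries the action `φ`: the first components vanish
  -- and the second ones agree by `hφ`.
  have hact : coSmashι A X ≫ coprod.desc κ'.left σ'.left = φ ≫ κ'.left := by
    have h₁ : coprod.desc κ'.left σ'.left ≫ (fst Q Q).left = coprod.desc 0 (𝟙 X) := by
      ext
      · rw [coprod.inl_desc_assoc, w', coprod.inl_desc]
      · rw [coprod.inr_desc_assoc, hσ', coprod.inr_desc]
    have h₂ : coprod.desc κ'.left σ'.left ≫ (snd Q Q).left = coprod.desc k (p ≫ s) := by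
      ext
      · rw [coprod.inl_desc_assoc, coprod.inl_desc, ← Over.comp_left, lift_snd]
        rfl
      · rw [coprod.inr_desc_assoc, coprod.inr_desc, ← Over.comp_left, lift_snd]
        rfl
    refine Over.tensorObj_ext _ _ ?_ ?_
    · refine (Category.assoc _ _ _).trans ((congrArg _ h₁).trans ((coSmashι_snd A X).trans ?_))
      exact ((Category.assoc _ _ _).trans ((congrArg _ w').trans comp_zero)).symm
    · refine (Category.assoc _ _ _).trans ((congrArg _ h₂).trans (hφ.trans ?_))
      refine Eq.symm ((Category.assoc _ _ _).trans (congrArg _ ?_))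
      exact congrArg (·.left) (lift_snd (toUnit _ ≫ η) κ)
  have hκ' : IsLimit (KernelFork.ofι κ'.left w') := isKernelFst κ w hk η
  -- Here `h` is exactly the compatibility needed to glue `k` and `1` into the addition `f`.
  obtain ⟨f, hf₁, hf₂⟩ := exists_desc_of_action w' hκ' hσ' φ hact k (𝟙 X) h
  have hfp : f ≫ p = (Q ⊗ Q).hom := by
    refine hom_ext_of_split w' hκ' hσ' ?_ ?_
    · rw [reassoc_of% hf₁, w]
      exact (Over.w κ').symm
    · rw [reassoc_of% hf₂]
      exact (Category.id_comp p).trans (Over.w σ').symm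
  refine (exists_commGrpObj_of_unital κ w hk η (Over.homMk f hfp) ?_ ?_).imp
    fun M hM => by rw [hM]; rfl
  · ext
    exact hf₁
  · ext
    exact hf₂

end BeckModuleCriterion

end HomologicalCategory

theorem theorem6p6 {C : Type u} [Category.{v} C] [HasZeroMorphisms C] [HasFiniteColimits C]
    [Homological C] {A G : C} (hA : IsAbelianObject A)
    (ψ : coSmash A G ⟶ A) (hψ : DeterminesAction ψ) :
    IsGModule ψ ↔
      conjugation (semidirectInl ψ) (semidirectInlNormalMono ψ hψ) =
          coSmashMap (𝟙 A) (semidirectProj ψ) ≫ ψ ∧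
        coSmashMap (𝟙 A) (semidirectProj ψ) ≫ ψ = pullbackAction (semidirectProj ψ) ψ := by
  have hact : coSmashι A (semidirect ψ) ≫
      coprod.desc (semidirectInl ψ) (semidirectProj ψ ≫ semidirectInr ψ) =
        (coSmashMap (𝟙 A) (semidirectProj ψ) ≫ ψ) ≫ semidirectInl ψ := by
    have h : coprod.desc (semidirectInl ψ) (semidirectProj ψ ≫ semidirectInr ψ) =
        coprod.map (𝟙 A) (semidirectProj ψ) ≫ semidirectπ ψ := by
      apply coprod.hom_ext
      · rw [coprod.inl_desc, coprod.inl_map_assoc, Category.id_comp, semidirectInl]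
      · rw [coprod.inr_desc, coprod.inr_map_assoc, semidirectInr]
    rw [h, ← Category.assoc, ← coSmashMap_ι, Category.assoc, semidirectπ_condition]
    simp only [semidirectInl, Category.assoc]
  rw [conjugation_eq_iff, ← hact]
  obtain ⟨hk⟩ := semidirectInl_isKernel ψ hψ
  exact ⟨fun h => ⟨conjugation_of_isBeckModule (semidirectInl_proj ψ) h, rfl⟩,
    fun h => isBeckModule_of_conjugation (semidirectInl_proj ψ) hk (semidirectInr_proj ψ) _ hact
      (h.1.trans hact)⟩
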